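/- Let $\Delta$ be a simplicial complex on the vertex set $[n]=\{1,\dots,n\}$, and for $T\subseteq[n]$ let $\Delta|_T$ be the restriction of $\Delta$ to $T$, i.e. the complex of all faces of $\Delta$ contained in $T$. Let $h\ge 0$ be an integer and suppose that $\Delta$ is a vertex minimal $h$-cycle: for some field $\Bbbk$, and for all $T\subseteq[n]$, the reduced simplicial homology $\widetilde H_h(\Delta|_T;\Bbbk)$ is nonzero if and only if $T=[n]$. Let $K$ be any field, let $I_\Delta\subseteq K[x_1,\dots,x_n]$ be the Stanley–Reisner ideal of $\Delta$, generated by the squarefree monomials $x_{i_1}\cdots x_{i_r}$ with $\{i_1,\dots,i_r\}\notin\Delta$, and let $s$ be the maximum degree of the minimal monomial generators of $I_\Delta$. Let $G$ be the $1$-skeleton of $\Delta$, i.e. the graph whose vertices and edges are the faces of $\Delta$ of dimension $0$ and $1$. Then $G$ is $\left\lceil \frac{sh}{s-1}\right\rceil$-connected. Here a graph is called $m$-connected if it has more than $m$ vertices and every graph obtained from it by deleting fewer than $m$ vertices together with their incident edges is connected. -/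

import Mathlib

/-! A simplicial complex on the vertex set `[n]` is modelled by Mathlib's
`PreAbstractSimplicialComplex (Fin n)`: a set of nonempty finite sets, closed under passing to
nonempty subsets.  The empty face is not recorded there, so it is added explicitly where needed. -/

universe u v

namespace PreAbstractSimplicialComplex

/-- The restriction of `Δ` to `T`: all the faces of `Δ` contained in `T`. -/
def restrict {n : ℕ} (Δ : PreAbstractSimplicialComplex (Fin n)) (T : Finset (Fin n)) :
    PreAbstractSimplicialComplex (Fin n) where
  faces := {σ | σ ∈ Δ.faces ∧ σ ⊆ T}
  isRelLowerSet_faces := fun _ hσ =>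
    ⟨(Δ.isRelLowerSet_faces hσ.1).1, fun _ hτσ hτ =>
      ⟨(Δ.isRelLowerSet_faces hσ.1).2 hτσ hτ, hτσ.trans hσ.2⟩⟩

/-- `σ` is a face of `Δ`, where the empty set counts as a face (of dimension `-1`). -/
def IsFace {n : ℕ} (Δ : PreAbstractSimplicialComplex (Fin n)) (σ : Finset (Fin n)) : Prop :=
  σ = ∅ ∨ σ ∈ Δ.faces

/-- The simplicial boundary map on formal `k`-linear combinations of all subsets of `[n]`, such a
combination being given by its family of coefficients:
a set `σ = {v₀ < v₁ < ⋯ < vᵢ}` is sent to `∑ⱼ (-1)ʲ (σ \ {vⱼ})`. -/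
noncomputable def boundary (k : Type*) [Field k] (n : ℕ) :
    (Finset (Fin n) → k) →ₗ[k] (Finset (Fin n) → k) :=
  Fintype.linearCombination k fun σ : Finset (Fin n) =>
    ∑ v ∈ σ, (-1 : k) ^ (σ.filter (· < v)).card • (Pi.single (σ.erase v) 1 : Finset (Fin n) → k)

/-- The space of reduced simplicial chains of dimension `i`: linear combinations of the faces of
dimension `i`, that is of the faces with `i + 1` elements, the empty face included. -/
def chains (k : Type*) [Field k] {n : ℕ} (Δ : PreAbstractSimplicialComplex (Fin n))
    (i : ℤ) : Submodule k (Finset (Fin n) → k) where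
  carrier := {c | ∀ σ, ¬ (Δ.IsFace σ ∧ (σ.card : ℤ) = i + 1) → c σ = 0}
  add_mem' hc hd σ hσ := by rw [Pi.add_apply, hc σ hσ, hd σ hσ, add_zero]
  zero_mem' _ _ := rfl
  smul_mem' a c hc σ hσ := by rw [Pi.smul_apply, hc σ hσ, smul_zero]

/-- The chains of dimension `i` with zero boundary. -/
noncomputable def cycles (k : Type*) [Field k] {n : ℕ} (Δ : PreAbstractSimplicialComplex (Fin n))
    (i : ℤ) : Submodule k (Finset (Fin n) → k) :=
  Δ.chains k i ⊓ LinearMap.ker (boundary k n)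

/-- The boundaries of the chains of dimension `i + 1`. -/
noncomputable def boundaries (k : Type*) [Field k] {n : ℕ}
    (Δ : PreAbstractSimplicialComplex (Fin n)) (i : ℤ) : Submodule k (Finset (Fin n) → k) :=
  (Δ.chains k (i + 1)).map (boundary k n)

/-- The `i`-th reduced simplicial homology of `Δ` over `k`: cycles modulo boundaries. -/
abbrev reducedHomology (k : Type*) [Field k] {n : ℕ} (Δ : PreAbstractSimplicialComplex (Fin n))
    (i : ℤ) : Type _ :=
  Δ.cycles k i ⧸ (Δ.boundaries k i).submoduleOf (Δ.cycles k i)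

/-- `Δ` is a vertex minimal `h`-cycle: for some field `k`, the `h`-th reduced homology over `k` of
the restriction of `Δ` to `T` is nonzero if and only if `T = [n]`. -/
def IsVertexMinimalCycle {n : ℕ} (Δ : PreAbstractSimplicialComplex (Fin n)) (h : ℤ) : Prop :=
  ∃ (k : Type u) (_ : Field k), ∀ T : Finset (Fin n),
    Nontrivial ((Δ.restrict T).reducedHomology k h) ↔ T = Finset.univ

/-- The Stanley–Reisner ideal of `Δ` in `K[x₁, …, xₙ]`: it is generated by the squarefree
monomials whose support is not a face of `Δ`. -/
noncomputable def stanleyReisnerIdeal (K : Type*) [Field K] {n : ℕ}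
    (Δ : PreAbstractSimplicialComplex (Fin n)) : Ideal (MvPolynomial (Fin n) K) :=
  Ideal.span {p | ∃ σ : Finset (Fin n), ¬ Δ.IsFace σ ∧ p = ∏ i ∈ σ, MvPolynomial.X i}

/-- The 1-skeleton of `Δ` as a graph: its vertices are the 0-dimensional faces of `Δ` and its
edges are the 1-dimensional faces. -/
def oneSkeleton {n : ℕ} (Δ : PreAbstractSimplicialComplex (Fin n)) :
    SimpleGraph {v : Fin n // {v} ∈ Δ.faces} where
  Adj u v := u ≠ v ∧ ({u.1, v.1} : Finset (Fin n)) ∈ Δ.faces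
  symm := ⟨fun u v h => ⟨h.1.symm, by rw [Finset.pair_comm]; exact h.2⟩⟩
  loopless := ⟨fun _ h => h.1 rfl⟩

end PreAbstractSimplicialComplex

/-- `M` (a set of exponent vectors) is a minimal set of monomial generators of the ideal `I`:
the monomials `x^a`, `a ∈ M`, generate `I`, and those of no proper subset of `M` do. -/
def IsMinimalMonomialGenerators {K : Type*} [Field K] {n : ℕ} (I : Ideal (MvPolynomial (Fin n) K))
    (M : Set (Fin n →₀ ℕ)) : Prop :=
  Minimal (fun N : Set (Fin n →₀ ℕ) =>
    Ideal.span ((fun a => MvPolynomial.monomial a (1 : K)) '' N) = I) M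

/-- `s` is the maximum degree of the minimal monomial generators of the monomial ideal `I`
(so in particular there is at least one generator). -/
def IsMaxGeneratorDegree {K : Type*} [Field K] {n : ℕ} (I : Ideal (MvPolynomial (Fin n) K))
    (s : ℕ) : Prop :=
  ∃ M : Set (Fin n →₀ ℕ), IsMinimalMonomialGenerators I M ∧
    IsGreatest ((fun a : Fin n →₀ ℕ => a.degree) '' M) s

/-- A graph is `m`-connected if it has more than `m` vertices and deleting fewer than `m` vertices,
with their incident edges, always leaves a connected graph. -/
def SimpleGraph.IsMConnected {V : Type*} (G : SimpleGraph V) (m : ℕ) : Prop :=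
  (m : ℕ∞) < ENat.card V ∧
    ∀ W : Finset V, W.card < m → (G.induce ((W : Set V)ᶜ)).Connected

/-! Two facts combine. First, if the minimal nonfaces of a complex on a vertex set `W` have at most
`s` elements and its homology in dimension `m - 1` is nonzero, then `s * m ≤ (s - 1) * |W|`
(`card_bound`, with `s = r + 1`). The induction removes a vertex `v` of a nonface `N`. By the
deletion-link sequence, the homology survives either in the deletion or, one dimension lower, in the
link, where `N \ {v}` is again a nonface. Carrying the size of `N` along (`card_bound_aux`) is what
closes the induction.

Second, suppose that deleting `W` disconnects the 1-skeleton, and let `A` be a component of what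
remains. Every face lies in `A ∪ W` or in the complement of `A`. Both are proper subsets, so their
restrictions have no `h`-th homology. Mayer-Vietoris (`exactAt_of_cover`) then forces nonzero
homology in dimension `h - 1` on their intersection `W`, and the first fact gives `|W| ≥ sh/(s-1)`.
-/

open PreAbstractSimplicialComplex Finset

namespace SimplicialChain

variable {k : Type*} [Field k] {n : ℕ}

/-! ### Contraction and wedge operators and their anticommutation relations. -/

/-- The sign `(-1)^j`, where `j` is the number of elements of `σ` below `v`. -/
def sign (k : Type*) [Field k] {n : ℕ} (v : Fin n) (σ : Finset (Fin n)) : k :=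
  (-1) ^ (σ.filter (· < v)).card

lemma sign_mul_self (v : Fin n) (σ : Finset (Fin n)) : sign k v σ * sign k v σ = 1 := by
  rw [sign, ← pow_add, Even.neg_one_pow (Even.add_self _)]

lemma sign_insert (v : Fin n) {w : Fin n} {σ : Finset (Fin n)} (hw : w ∉ σ) :
    sign k v (insert w σ) = if w < v then -sign k v σ else sign k v σ := by
  unfold sign
  rw [filter_insert]
  split_ifs with h
  · rw [card_insert_of_notMem (by simp [hw]), pow_succ]; ring
  · rfl

lemma sign_insert_self (v : Fin n) {σ : Finset (Fin n)} (hv : v ∉ σ) :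
    sign k v (insert v σ) = sign k v σ := by
  rw [sign_insert v hv, if_neg (lt_irrefl v)]

/-- Exactly one of `v`, `w` lies below the other, so inserting it flips exactly one sign. -/
lemma sign_swap {v w : Fin n} (hvw : v ≠ w) {σ : Finset (Fin n)} (hv : v ∉ σ) (hw : w ∉ σ) :
    sign k v σ * sign k w (insert v σ) = -(sign k w σ * sign k v (insert w σ)) := by
  rw [sign_insert w hv, sign_insert v hw]
  rcases lt_or_gt_of_ne hvw with h | h
  · rw [if_pos h, if_neg h.asymm]; ring
  · rw [if_pos h, if_neg h.asymm]; ring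

/-- Contraction of a chain with a vertex: the component of the boundary that removes `v`. -/
def contract (v : Fin n) (c : Finset (Fin n) → k) : Finset (Fin n) → k :=
  fun σ => if v ∈ σ then 0 else sign k v σ * c (insert v σ)

/-- Multiplication of a chain with a vertex. -/
def wedge (v : Fin n) (c : Finset (Fin n) → k) : Finset (Fin n) → k :=
  fun σ => if v ∈ σ then sign k v σ * c (σ.erase v) else 0

lemma contract_of_notMem {v : Fin n} {σ : Finset (Fin n)} (hv : v ∉ σ)
    (c : Finset (Fin n) → k) : contract v c σ = sign k v σ * c (insert v σ) := if_neg hv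

lemma contract_of_mem {v : Fin n} {σ : Finset (Fin n)} (hv : v ∈ σ)
    (c : Finset (Fin n) → k) : contract v c σ = 0 := if_pos hv

lemma wedge_of_notMem {v : Fin n} {σ : Finset (Fin n)} (hv : v ∉ σ)
    (c : Finset (Fin n) → k) : wedge v c σ = 0 := if_neg hv

lemma wedge_insert {v : Fin n} {σ : Finset (Fin n)} (hv : v ∉ σ)
    (c : Finset (Fin n) → k) : wedge v c (insert v σ) = sign k v σ * c σ := by
  rw [wedge, if_pos (mem_insert_self v σ), sign_insert_self v hv, erase_insert hv]

lemma boundary_apply (c : Finset (Fin n) → k) (τ : Finset (Fin n)) :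
    boundary k n c τ = ∑ v, contract v c τ := by
  have key : ∀ σ v : _, c σ • (if v ∈ σ then (-1 : k) ^ (σ.filter (· < v)).card •
      (Pi.single (σ.erase v) 1 : Finset (Fin n) → k) τ else 0) =
      if v ∉ τ ∧ σ = insert v τ then sign k v τ * c (insert v τ) else 0 := by
    intro σ v
    by_cases hv : v ∈ σ
    · by_cases h : τ = σ.erase v
      · have h1 : v ∉ τ := by rw [h]; exact notMem_erase v σ
        have h2 : σ = insert v τ := by rw [h, insert_erase hv]
        rw [if_pos hv, if_pos ⟨h1, h2⟩, ← h, Pi.single_eq_same, h2]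
        have := sign_insert_self (k := k) v h1
        rw [← this]
        simp only [sign, smul_eq_mul]; ring
      · rw [if_pos hv, Pi.single_eq_of_ne h, if_neg, smul_zero, smul_zero]
        rintro ⟨h1, rfl⟩
        exact h (erase_insert h1).symm
    · rw [if_neg hv, if_neg, smul_zero]
      rintro ⟨-, rfl⟩
      exact hv (mem_insert_self v τ)
  have h1 : boundary k n c τ = ∑ σ, ∑ v, c σ • (if v ∈ σ then
      (-1 : k) ^ (σ.filter (· < v)).card •
        (Pi.single (σ.erase v) 1 : Finset (Fin n) → k) τ else 0) := by
    rw [boundary, Fintype.linearCombination_apply, Finset.sum_apply]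
    refine sum_congr rfl fun σ _ => ?_
    rw [Pi.smul_apply, Finset.sum_apply, smul_sum, ← sum_subset (subset_univ σ)]
    · refine sum_congr rfl fun v hv => ?_
      rw [if_pos hv]; rfl
    · intro v _ hv
      rw [if_neg hv, smul_zero]
  rw [h1, sum_comm]
  refine sum_congr rfl fun v _ => ?_
  simp_rw [key]
  by_cases hv : v ∈ τ
  · simp [contract, hv]
  · simp [contract, hv]

lemma boundary_eq_sum (c : Finset (Fin n) → k) : boundary k n c = ∑ v, contract v c := by
  ext τ
  rw [boundary_apply, Finset.sum_apply]

lemma contract_contract_self (v : Fin n) (c : Finset (Fin n) → k) :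
    contract v (contract v c) = 0 := by
  ext σ
  by_cases hv : v ∈ σ
  · exact contract_of_mem hv _
  · rw [contract_of_notMem hv, contract_of_mem (mem_insert_self v σ), mul_zero]; rfl

lemma contract_contract {v w : Fin n} (hvw : v ≠ w) (c : Finset (Fin n) → k) :
    contract v (contract w c) = -contract w (contract v c) := by
  ext σ
  rw [Pi.neg_apply]
  by_cases hv : v ∈ σ
  · rw [contract_of_mem hv]
    by_cases hw : w ∈ σ
    · rw [contract_of_mem hw, neg_zero]
    · rw [contract_of_notMem hw, contract_of_mem (mem_insert_of_mem hv), mul_zero, neg_zero]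
  by_cases hw : w ∈ σ
  · rw [contract_of_mem hw, contract_of_notMem hv, contract_of_mem (mem_insert_of_mem hw),
      mul_zero, neg_zero]
  rw [contract_of_notMem hv, contract_of_notMem hw, contract_of_notMem (by simp [hvw.symm, hw]),
    contract_of_notMem (by simp [hvw, hv]), ← mul_assoc, ← mul_assoc, sign_swap hvw hv hw,
    insert_comm, neg_mul]

lemma contract_wedge_self (v : Fin n) (c : Finset (Fin n) → k) :
    contract v (wedge v c) + wedge v (contract v c) = c := by
  ext σ
  rw [Pi.add_apply]
  by_cases hv : v ∈ σ
  · obtain ⟨ρ, hρ, rfl⟩ : ∃ ρ, v ∉ ρ ∧ insert v ρ = σ := ⟨_, notMem_erase v σ, insert_erase hv⟩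
    rw [contract_of_mem hv, wedge_insert hρ, contract_of_notMem hρ, ← mul_assoc, sign_mul_self,
      one_mul, zero_add]
  · rw [contract_of_notMem hv, wedge_of_notMem hv, wedge_insert hv, ← mul_assoc, sign_mul_self,
      one_mul, add_zero]

lemma contract_wedge {v w : Fin n} (hvw : v ≠ w) (c : Finset (Fin n) → k) :
    contract w (wedge v c) + wedge v (contract w c) = 0 := by
  ext σ
  rw [Pi.add_apply, Pi.zero_apply]
  by_cases hv : v ∈ σ
  · obtain ⟨ρ, hρ, rfl⟩ : ∃ ρ, v ∉ ρ ∧ insert v ρ = σ := ⟨_, notMem_erase v σ, insert_erase hv⟩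
    rw [wedge_insert hρ]
    by_cases hw : w ∈ ρ
    · rw [contract_of_mem hw, contract_of_mem (mem_insert_of_mem hw), mul_zero, add_zero]
    · have h1 : w ∉ insert v ρ := by simp [hvw.symm, hw]
      have h2 : v ∉ insert w ρ := by simp [hvw, hρ]
      rw [contract_of_notMem h1, insert_comm, wedge_insert h2, contract_of_notMem hw]
      rw [sign_insert w hρ, sign_insert v hw]
      rcases lt_or_gt_of_ne hvw with h | h
      · rw [if_pos h, if_neg h.asymm]; ring
      · rw [if_pos h, if_neg h.asymm]; ring
  · rw [wedge_of_notMem hv, add_zero]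
    by_cases hw : w ∈ σ
    · rw [contract_of_mem hw]
    · rw [contract_of_notMem hw, wedge_of_notMem (by simp [hvw, hv]), mul_zero]

lemma wedge_sum {ι : Type*} (s : Finset ι) (v : Fin n) (c : ι → Finset (Fin n) → k) :
    wedge v (∑ i ∈ s, c i) = ∑ i ∈ s, wedge v (c i) := by
  ext σ
  by_cases hv : v ∈ σ <;> simp [wedge, hv, mul_sum]

lemma contract_sum {ι : Type*} (s : Finset ι) (v : Fin n) (c : ι → Finset (Fin n) → k) :
    contract v (∑ i ∈ s, c i) = ∑ i ∈ s, contract v (c i) := by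
  ext σ
  by_cases hv : v ∈ σ <;> simp [contract, hv, mul_sum]

lemma wedge_zero (v : Fin n) : wedge v (0 : Finset (Fin n) → k) = 0 := by
  ext σ; simp [wedge]

lemma contract_zero (v : Fin n) : contract v (0 : Finset (Fin n) → k) = 0 := by
  ext σ; simp [contract]

/-- Multiplication with a vertex is a contracting homotopy of the full simplex. -/
lemma boundary_wedge (v : Fin n) (c : Finset (Fin n) → k) :
    boundary k n (wedge v c) = c - wedge v (boundary k n c) := by
  rw [eq_sub_iff_add_eq, boundary_eq_sum, boundary_eq_sum, wedge_sum, ← sum_add_distrib,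
    sum_eq_single v, contract_wedge_self]
  · intro w _ hw
    exact contract_wedge hw.symm c
  · intro h
    exact absurd (mem_univ v) h

lemma boundary_contract (v : Fin n) (c : Finset (Fin n) → k) :
    boundary k n (contract v c) = -contract v (boundary k n c) := by
  rw [boundary_eq_sum, boundary_eq_sum, contract_sum, ← sum_neg_distrib]
  refine sum_congr rfl fun w _ => ?_
  by_cases hw : w = v
  · rw [hw, contract_contract_self, neg_zero]
  · exact contract_contract hw c

/-- In the double sum of contractions the terms for `(v, w)` and `(w, v)` cancel, and the diagonal
terms vanish. -/
lemma boundary_boundary (c : Finset (Fin n) → k) : boundary k n (boundary k n c) = 0 := by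
  rw [boundary_eq_sum, boundary_eq_sum]
  simp_rw [contract_sum]
  rw [← sum_product']
  refine sum_involution (fun p _ => p.swap) ?_ ?_ (fun _ _ => mem_univ _) (fun _ _ => rfl)
  · rintro ⟨v, w⟩ -
    by_cases hvw : v = w
    · subst hvw
      simp [contract_contract_self]
    · simp [contract_contract hvw c]
  · rintro ⟨v, w⟩ - h h'
    have hvw : w = v := (Prod.ext_iff.1 h').1
    subst hvw
    exact h (contract_contract_self _ c)

/-! ### Chains supported on a family of faces, and exactness. -/

/-- The chain `c` is a combination of members of `F` with `m` elements. -/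
def SupportedOn (F : Set (Finset (Fin n))) (m : ℕ) (c : Finset (Fin n) → k) : Prop :=
  ∀ σ, c σ ≠ 0 → σ ∈ F ∧ σ.card = m

/-- Every cycle supported on the members of `F` with `m` elements is a boundary of a chain
supported on the members of `F` with `m + 1` elements. -/
def ExactAt (k : Type*) [Field k] {n : ℕ} (F : Set (Finset (Fin n))) (m : ℕ) : Prop :=
  ∀ c : Finset (Fin n) → k, SupportedOn F m c → boundary k n c = 0 →
    ∃ d, SupportedOn F (m + 1) d ∧ boundary k n d = c

/-- The members of `F` avoiding `v`. -/
def deletion (F : Set (Finset (Fin n))) (v : Fin n) : Set (Finset (Fin n)) :=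
  {σ | σ ∈ F ∧ v ∉ σ}

/-- The link of the vertex `v` in `F`. -/
def link (F : Set (Finset (Fin n))) (v : Fin n) : Set (Finset (Fin n)) :=
  {σ | v ∉ σ ∧ insert v σ ∈ F}

lemma SupportedOn.mono {F G : Set (Finset (Fin n))} {m : ℕ} {c : Finset (Fin n) → k}
    (hc : SupportedOn F m c) (h : F ⊆ G) : SupportedOn G m c :=
  fun σ hσ => ⟨h (hc σ hσ).1, (hc σ hσ).2⟩

lemma supportedOn_zero (F : Set (Finset (Fin n))) (m : ℕ) :
    SupportedOn F m (0 : Finset (Fin n) → k) := fun _ h => absurd rfl h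

lemma SupportedOn.add {F : Set (Finset (Fin n))} {m : ℕ} {c d : Finset (Fin n) → k}
    (hc : SupportedOn F m c) (hd : SupportedOn F m d) : SupportedOn F m (c + d) := by
  intro σ hσ
  by_cases h : c σ = 0
  · exact hd σ fun h' => hσ (by rw [Pi.add_apply, h, h', add_zero])
  · exact hc σ h

lemma SupportedOn.neg {F : Set (Finset (Fin n))} {m : ℕ} {c : Finset (Fin n) → k}
    (hc : SupportedOn F m c) : SupportedOn F m (-c) :=
  fun σ hσ => hc σ fun h => hσ (by rw [Pi.neg_apply, h, neg_zero])

lemma SupportedOn.sub {F : Set (Finset (Fin n))} {m : ℕ} {c d : Finset (Fin n) → k}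
    (hc : SupportedOn F m c) (hd : SupportedOn F m d) : SupportedOn F m (c - d) := by
  rw [sub_eq_add_neg]
  exact hc.add hd.neg

lemma SupportedOn.contract {F : Set (Finset (Fin n))} {m : ℕ} {c : Finset (Fin n) → k}
    (hc : SupportedOn F (m + 1) c) (v : Fin n) : SupportedOn (link F v) m (contract v c) := by
  intro σ hσ
  have hv : v ∉ σ := fun h => hσ (contract_of_mem h c)
  rw [contract_of_notMem hv] at hσ
  obtain ⟨h1, h2⟩ := hc _ (right_ne_zero_of_mul hσ)
  rw [card_insert_of_notMem hv] at h2
  exact ⟨⟨hv, h1⟩, by omega⟩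

lemma SupportedOn.wedge {F G : Set (Finset (Fin n))} {m : ℕ} {c : Finset (Fin n) → k} {v : Fin n}
    (hc : SupportedOn G m c) (h : ∀ σ ∈ G, v ∉ σ → insert v σ ∈ F) :
    SupportedOn F (m + 1) (wedge v c) := by
  intro σ hσ
  have hv : v ∈ σ := by
    by_contra hv
    exact hσ (wedge_of_notMem hv c)
  rw [SimplicialChain.wedge, if_pos hv] at hσ
  obtain ⟨h1, h2⟩ := hc _ (right_ne_zero_of_mul hσ)
  have h3 := h _ h1 (notMem_erase v σ)
  rw [insert_erase hv] at h3
  exact ⟨h3, by rw [← card_erase_add_one hv, h2]⟩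

lemma link_subset_deletion {F : Set (Finset (Fin n))} (hF : IsLowerSet F) (v : Fin n) :
    link F v ⊆ deletion F v := fun σ hσ => ⟨hF (subset_insert v σ) hσ.2, hσ.1⟩

lemma deletion_subset (F : Set (Finset (Fin n))) (v : Fin n) : deletion F v ⊆ F :=
  fun _ hσ => hσ.1

lemma isLowerSet_deletion {F : Set (Finset (Fin n))} (hF : IsLowerSet F) (v : Fin n) :
    IsLowerSet (deletion F v) := fun _ _ hτσ hσ => ⟨hF hτσ hσ.1, fun h => hσ.2 (hτσ h)⟩

lemma isLowerSet_link {F : Set (Finset (Fin n))} (hF : IsLowerSet F) (v : Fin n) :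
    IsLowerSet (link F v) :=
  fun _ _ hτσ hσ => ⟨fun h => hσ.1 (hτσ h), hF (insert_subset_insert v hτσ) hσ.2⟩

lemma SupportedOn.boundary {F : Set (Finset (Fin n))} (hF : IsLowerSet F) {m : ℕ}
    {c : Finset (Fin n) → k} (hc : SupportedOn F (m + 1) c) :
    SupportedOn F m (boundary k n c) := by
  intro σ hσ
  rw [boundary_apply] at hσ
  obtain ⟨v, -, hv⟩ := exists_ne_zero_of_sum_ne_zero hσ
  exact (hc.contract v).mono ((link_subset_deletion hF v).trans (deletion_subset F v)) σ hv

lemma empty_mem_of_not_exactAt {F : Set (Finset (Fin n))} (hF : IsLowerSet F) {m : ℕ}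
    (hm : ¬ ExactAt k F m) : ∅ ∈ F := by
  by_contra h
  refine hm fun c hc _ => ⟨0, supportedOn_zero _ _, ?_⟩
  rw [map_zero]
  ext σ
  by_contra h'
  exact h (hF (empty_subset σ) (hc σ (Ne.symm h')).1)

/-! ### Acyclicity of cones, deletion-link and Mayer-Vietoris. -/

/-- A cone is acyclic. -/
lemma exactAt_of_cone {F : Set (Finset (Fin n))} {v : Fin n}
    (h : ∀ σ ∈ F, v ∉ σ → insert v σ ∈ F) (m : ℕ) : ExactAt k F m := fun c hc hc0 =>
  ⟨wedge v c, hc.wedge h, by rw [boundary_wedge, hc0, wedge_zero, sub_zero]⟩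

/-- The part of the long exact sequence of a deletion and a link that is used here. -/
lemma exactAt_of_deletion_link {F : Set (Finset (Fin n))} (hF : IsLowerSet F) {v : Fin n} {m : ℕ}
    (hd : ExactAt k (deletion F v) (m + 1)) (hl : ExactAt k (link F v) m) :
    ExactAt k F (m + 1) := by
  intro c hc hc0
  obtain ⟨a, ha, hac⟩ := hl (contract v c) (hc.contract v)
    (by rw [boundary_contract, hc0, contract_zero, neg_zero])
  have hwa : SupportedOn F (m + 1 + 1) (wedge v a) := ha.wedge fun σ hσ _ => hσ.2
  have hb : SupportedOn (deletion F v) (m + 1) (contract v (wedge v c)) := by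
    intro σ hσ
    have hv : v ∉ σ := fun h => hσ (contract_of_mem h _)
    rw [contract_of_notMem hv, wedge_insert hv] at hσ
    obtain ⟨h1, h2⟩ := hc σ (right_ne_zero_of_mul (right_ne_zero_of_mul hσ))
    exact ⟨⟨h1, hv⟩, h2⟩
  -- The `v`-part of `c` is the wedge of `v` with `contract v c`, which is the boundary of `a`;
  -- hence adding the boundary of `wedge v a` cancels it and leaves a cycle in the deletion.
  have hbc : c + boundary k n (wedge v a) = contract v (wedge v c) + a := by
    rw [boundary_wedge, hac]
    nth_rewrite 1 [← contract_wedge_self v c]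
    abel
  obtain ⟨d, hds, hdc⟩ := hd _ (hb.add (ha.mono (link_subset_deletion hF v)))
    (by rw [← hbc, map_add, hc0, boundary_boundary, add_zero])
  refine ⟨d - wedge v a, (hds.mono (deletion_subset F v)).sub hwa, ?_⟩
  rw [map_sub, hdc, ← hbc, add_sub_cancel_right]

/-- The part of the Mayer-Vietoris sequence that is used here. -/
lemma exactAt_of_cover {F : Set (Finset (Fin n))} (hF : IsLowerSet F) {S T : Finset (Fin n)}
    (hST : ∀ σ ∈ F, σ ⊆ S ∨ σ ⊆ T) {m : ℕ}
    (hS : ExactAt k {σ | σ ∈ F ∧ σ ⊆ S} (m + 1)) (hT : ExactAt k {σ | σ ∈ F ∧ σ ⊆ T} (m + 1))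
    (hI : ExactAt k {σ | σ ∈ F ∧ σ ⊆ S ∩ T} m) : ExactAt k F (m + 1) := by
  have hlow : ∀ U : Finset (Fin n), IsLowerSet {σ | σ ∈ F ∧ σ ⊆ U} :=
    fun U σ τ hτσ hσ => ⟨hF hτσ hσ.1, hτσ.trans hσ.2⟩
  intro c hc hc0
  obtain ⟨a, ha⟩ : ∃ a : Finset (Fin n) → k, a = fun σ => if σ ⊆ S then c σ else 0 := ⟨_, rfl⟩
  have haS : SupportedOn {σ | σ ∈ F ∧ σ ⊆ S} (m + 1) a := by
    intro σ hσ
    rw [ha] at hσ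
    obtain ⟨h1, h2⟩ := ite_ne_right_iff.1 hσ
    exact ⟨⟨(hc σ h2).1, h1⟩, (hc σ h2).2⟩
  have hbT : SupportedOn {σ | σ ∈ F ∧ σ ⊆ T} (m + 1) (c - a) := by
    intro σ hσ
    have h1 : ¬ σ ⊆ S := fun h => hσ (by rw [Pi.sub_apply, ha]; simp [h])
    have h2 : c σ ≠ 0 := fun h => hσ (by rw [Pi.sub_apply, ha]; simp [h])
    exact ⟨⟨(hc σ h2).1, (hST σ (hc σ h2).1).resolve_left h1⟩, (hc σ h2).2⟩
  have hab : boundary k n (c - a) = -boundary k n a := by rw [map_sub, hc0, zero_sub]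
  -- As `c` is a cycle, its two pieces have opposite boundaries, so this boundary lives on both
  -- sides of the cover.
  have hbdT : SupportedOn {σ | σ ∈ F ∧ σ ⊆ T} m (boundary k n a) := by
    have := (hbT.boundary (hlow T)).neg
    rwa [hab, neg_neg] at this
  have hbd : SupportedOn {σ | σ ∈ F ∧ σ ⊆ S ∩ T} m (boundary k n a) := fun σ hσ =>
    ⟨⟨(hbdT σ hσ).1.1, subset_inter (haS.boundary (hlow S) σ hσ).1.2 (hbdT σ hσ).1.2⟩,
      (hbdT σ hσ).2⟩
  obtain ⟨e, he, hea⟩ := hI _ hbd (boundary_boundary a)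
  have heS : SupportedOn {σ | σ ∈ F ∧ σ ⊆ S} (m + 1) e :=
    he.mono fun σ hσ => ⟨hσ.1, hσ.2.trans inter_subset_left⟩
  have heT : SupportedOn {σ | σ ∈ F ∧ σ ⊆ T} (m + 1) e :=
    he.mono fun σ hσ => ⟨hσ.1, hσ.2.trans inter_subset_right⟩
  -- Shifting `e` from one piece to the other turns both into cycles without changing their sum.
  obtain ⟨p, hp, hpa⟩ := hS _ (haS.sub heS) (by rw [map_sub, hea, sub_self])
  obtain ⟨q, hq, hqa⟩ := hT _ (hbT.add heT) (by rw [map_add, hea, hab, neg_add_cancel])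
  refine ⟨p + q, (hp.mono fun σ hσ => hσ.1).add (hq.mono fun σ hσ => hσ.1), ?_⟩
  rw [map_add, hpa, hqa]
  abel

/-! ### The bound on the number of vertices. -/

/-- Every subset of `W` all of whose subsets with at most `s` elements are in `F` is in `F`, that
is, the minimal subsets of `W` outside `F` have at most `s` elements. -/
def NonfacesGeneratedBy (F : Set (Finset (Fin n))) (W : Finset (Fin n)) (s : ℕ) : Prop :=
  ∀ σ ⊆ W, (∀ τ ⊆ σ, τ.card ≤ s → τ ∈ F) → σ ∈ F

lemma NonfacesGeneratedBy.deletion {F : Set (Finset (Fin n))} {W : Finset (Fin n)} {s : ℕ}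
    (h : NonfacesGeneratedBy F W s) (v : Fin n) :
    NonfacesGeneratedBy (deletion F v) (W.erase v) s := fun σ hσ hτ =>
  ⟨h σ (hσ.trans (erase_subset v W)) fun τ h1 h2 => (hτ τ h1 h2).1,
    fun hv => notMem_erase v W (hσ hv)⟩

/-- Removing `v` from a small subset of `insert v σ` gives a small subset of `σ`. That subset lies
in the link, so the original one lies in `F`. -/
lemma NonfacesGeneratedBy.link {F : Set (Finset (Fin n))} (hF : IsLowerSet F)
    {W : Finset (Fin n)} {s : ℕ} (h : NonfacesGeneratedBy F W s) {v : Fin n} (hv : v ∈ W) :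
    NonfacesGeneratedBy (link F v) (W.erase v) s := by
  intro σ hσ hτ
  refine ⟨fun hv => notMem_erase v W (hσ hv), h _ ?_ fun τ h1 h2 => ?_⟩
  · exact insert_subset hv (hσ.trans (erase_subset v W))
  · refine hF ?_ (hτ (τ.erase v) ?_ ((card_le_card (erase_subset v τ)).trans h2)).2
    · exact insert_erase_subset v τ
    · exact subset_insert_iff.1 h1

/-- If the homology of a complex on the vertex set `W` does not vanish in dimension `m - 1` and its
minimal nonfaces have at most `r + 1` elements, then `(r + 1) * m ≤ W.card * r`; a nonface with few
elements improves the bound. -/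
lemma card_bound_aux (r w : ℕ) : ∀ (W : Finset (Fin n)), W.card = w →
    ∀ (F : Set (Finset (Fin n))), IsLowerSet F → (∀ σ ∈ F, σ ⊆ W) →
    NonfacesGeneratedBy F W (r + 1) → ∀ m, ¬ ExactAt k F m →
    (∀ N ⊆ W, N ∉ F → (r + 1) * m + (r + 1) ≤ W.card * r + N.card) ∧
      (r + 1) * m ≤ W.card * r := by
  induction w with
  | zero =>
    intro W hW F hF hFW hFs m hm
    rw [card_eq_zero] at hW
    subst hW
    have hne := empty_mem_of_not_exactAt hF hm
    refine ⟨fun N hN hNF => absurd ((subset_empty.1 hN) ▸ hne) hNF, ?_⟩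
    rcases m with _ | m
    · simp
    refine absurd (fun c hc _ => ⟨0, supportedOn_zero _ _, ?_⟩) hm
    rw [map_zero]
    ext σ
    by_contra h'
    obtain ⟨h1, h2⟩ := hc σ (Ne.symm h')
    rw [subset_empty.1 (hFW σ h1), card_empty] at h2
    omega
  | succ w ih =>
    intro W hW F hF hFW hFs m hm
    have hne := empty_mem_of_not_exactAt hF hm
    have main : ∀ N ⊆ W, N ∉ F → (r + 1) * m + (r + 1) ≤ W.card * r + N.card := by
      intro N hN hNF
      obtain ⟨v, hv⟩ : N.Nonempty := nonempty_of_ne_empty fun h => hNF (h ▸ hne)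
      have hNc : 1 ≤ N.card := card_pos.2 ⟨v, hv⟩
      rw [hW]
      -- For `m = 0` no lower dimension is left for the link, but `1 ≤ N.card` already gives the
      -- bound.
      rcases m with _ | m
      · have : (w + 1) * r = w * r + r := by ring
        rw [this]
        simp only [mul_zero, zero_add]
        have := Nat.zero_le (w * r)
        omega
      have hWv : (W.erase v).card = w := by rw [card_erase_of_mem (hN hv), hW]; rfl
      have hsub : ∀ σ ∈ deletion F v, σ ⊆ W.erase v := fun σ hσ =>
        subset_erase.2 ⟨hFW σ hσ.1, hσ.2⟩
      -- In the link `m`, `W.card` and `N.card` each drop by one, so both sides drop by `r + 1`. In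
      -- the deletion the bound without `N` suffices, because `r + 1 ≤ r + N.card`.
      by_cases hd : ExactAt k (deletion F v) (m + 1)
      · have hl : ¬ ExactAt k (link F v) m := fun hl => hm (exactAt_of_deletion_link hF hd hl)
        have := (ih (W.erase v) hWv (link F v) (isLowerSet_link hF v)
          (fun σ hσ => hsub σ (link_subset_deletion hF v hσ)) (hFs.link hF (hN hv)) m hl).1
          (N.erase v) (erase_subset_erase v hN)
          (fun h => hNF (by simpa [insert_erase hv] using h.2))
        rw [hWv, card_erase_of_mem hv] at this
        zify [hNc] at this ⊢
        linarith
      · have := (ih (W.erase v) hWv (deletion F v) (isLowerSet_deletion hF v) hsub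
          (hFs.deletion v) (m + 1) hd).2
        rw [hWv] at this
        nlinarith
    refine ⟨main, ?_⟩
    -- If all small subsets are faces, `F` is the full simplex on a nonempty `W`, hence a cone.
    -- Otherwise a nonface with at most `r + 1` elements absorbs the extra `r + 1` in `main`.
    by_cases hall : ∀ τ ⊆ W, τ.card ≤ r + 1 → τ ∈ F
    · have hWF := hFs W subset_rfl hall
      obtain ⟨v, hv⟩ : W.Nonempty := card_pos.1 (by omega)
      exact absurd (exactAt_of_cone (v := v)
        (fun σ hσ _ => hF (insert_subset hv (hFW σ hσ)) hWF) m) hm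
    · push Not at hall
      obtain ⟨τ, h1, h2, h3⟩ := hall
      have := main τ h1 h3
      omega

lemma card_bound {F : Set (Finset (Fin n))} (hF : IsLowerSet F) {W : Finset (Fin n)}
    (hFW : ∀ σ ∈ F, σ ⊆ W) {r : ℕ} (hFs : NonfacesGeneratedBy F W (r + 1)) {m : ℕ}
    (hm : ¬ ExactAt k F m) : (r + 1) * m ≤ W.card * r :=
  (card_bound_aux r W.card W rfl F hF hFW hFs m hm).2

end SimplicialChain

/-! ### Translation from reduced homology and the Stanley-Reisner ideal. -/

namespace PreAbstractSimplicialComplex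

open SimplicialChain

variable {n : ℕ} (Δ : PreAbstractSimplicialComplex (Fin n))

lemma isLowerSet_isFace : IsLowerSet {σ | Δ.IsFace σ} := by
  intro σ τ hτσ hσ
  rcases τ.eq_empty_or_nonempty with h | h
  · exact Or.inl h
  · rcases hσ with rfl | hσ
    · exact Or.inl (subset_empty.1 hτσ)
    · exact Or.inr ((Δ.isRelLowerSet_faces hσ).2 hτσ h)

lemma isFace_restrict (T : Finset (Fin n)) :
    {σ | (Δ.restrict T).IsFace σ} = {σ | σ ∈ {σ | Δ.IsFace σ} ∧ σ ⊆ T} := by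
  ext σ
  constructor
  · rintro (rfl | h)
    · exact ⟨Or.inl rfl, empty_subset T⟩
    · exact ⟨Or.inr h.1, h.2⟩
  · rintro ⟨rfl | h, h'⟩
    · exact Or.inl rfl
    · exact Or.inr ⟨h, h'⟩

lemma mem_chains_iff {k : Type*} [Field k] (c : Finset (Fin n) → k) (i : ℤ) (m : ℕ)
    (hi : i + 1 = m) : c ∈ Δ.chains k i ↔ SupportedOn {σ | Δ.IsFace σ} m c := by
  change (∀ σ, ¬ (Δ.IsFace σ ∧ (σ.card : ℤ) = i + 1) → c σ = 0) ↔ _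
  rw [hi]
  simp only [Nat.cast_inj]
  exact forall_congr' fun σ => not_imp_comm

/-- `ExactAt` counts elements of faces, hence the shift from dimension `h` to `h + 1`. -/
lemma nontrivial_reducedHomology_iff (k : Type*) [Field k] (h : ℕ) :
    Nontrivial (Δ.reducedHomology k (h : ℤ)) ↔ ¬ ExactAt k {σ | Δ.IsFace σ} (h + 1) := by
  rw [reducedHomology, Submodule.Quotient.nontrivial_iff, Ne, Submodule.submoduleOf_eq_top,
    not_iff_not]
  constructor
  · intro H c hc hc0
    obtain ⟨d, hd, hdc⟩ := H ⟨(Δ.mem_chains_iff c h (h + 1) (by simp)).2 hc, hc0⟩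
    exact ⟨d, (Δ.mem_chains_iff d (h + 1) (h + 1 + 1) (by simp)).1 hd, hdc⟩
  · rintro H c ⟨hc, hc0⟩
    obtain ⟨d, hd, hdc⟩ := H c ((Δ.mem_chains_iff c h (h + 1) (by simp)).1 hc) hc0
    exact ⟨d, (Δ.mem_chains_iff d (h + 1) (h + 1 + 1) (by simp)).2 hd, hdc⟩

lemma prod_X_eq_monomial (K : Type*) [Field K] (σ : Finset (Fin n)) :
    ∏ i ∈ σ, (MvPolynomial.X i : MvPolynomial (Fin n) K) =
      MvPolynomial.monomial (∑ i ∈ σ, Finsupp.single i 1) 1 := by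
  rw [MvPolynomial.monomial_sum_one]
  rfl

lemma sum_single_apply (σ : Finset (Fin n)) (j : Fin n) :
    (∑ i ∈ σ, Finsupp.single i 1 : Fin n →₀ ℕ) j = if j ∈ σ then 1 else 0 := by
  rw [Finsupp.finsetSum_apply]
  simp [Finsupp.single_apply]

lemma stanleyReisnerIdeal_eq (K : Type*) [Field K] :
    Δ.stanleyReisnerIdeal K = Ideal.span ((fun a => MvPolynomial.monomial a (1 : K)) ''
      ((fun σ : Finset (Fin n) => ∑ i ∈ σ, Finsupp.single i 1) '' {σ | ¬ Δ.IsFace σ})) := by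
  rw [stanleyReisnerIdeal]
  congr 1
  ext p
  simp only [Set.mem_ofPred_eq, Set.mem_image, exists_exists_and_eq_and, prod_X_eq_monomial]
  exact exists_congr fun σ => and_congr_right fun _ => eq_comm

/-- The support of a monomial in the Stanley-Reisner ideal contains a nonface. -/
lemma exists_nonface_of_monomial_mem {K : Type*} [Field K] {a : Fin n →₀ ℕ}
    (ha : MvPolynomial.monomial a (1 : K) ∈ Δ.stanleyReisnerIdeal K) :
    ∃ σ, ¬ Δ.IsFace σ ∧ σ ⊆ a.support ∧ σ.card ≤ a.degree := by
  rw [stanleyReisnerIdeal_eq, MvPolynomial.mem_ideal_span_monomial_image] at ha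
  obtain ⟨-, ⟨σ, hσ, rfl⟩, hle⟩ := ha a (by simp)
  refine ⟨σ, hσ, fun j hj => ?_, ?_⟩
  · have := hle j
    rw [sum_single_apply, if_pos hj] at this
    rw [Finsupp.mem_support_iff]
    omega
  · have h1 := Finsupp.degree_mono hle
    simpa using h1

/-- Some generator of degree at most `s` divides the monomial of `σ`, and its support contains a
nonface no larger than its degree. -/
lemma exists_small_nonface {K : Type*} [Field K] {s : ℕ}
    (hs : IsMaxGeneratorDegree (Δ.stanleyReisnerIdeal K) s) {σ : Finset (Fin n)}
    (hσ : ¬ Δ.IsFace σ) : ∃ τ ⊆ σ, τ.card ≤ s ∧ ¬ Δ.IsFace τ := by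
  obtain ⟨M, hM, -, hMs⟩ := hs
  have hmem : ∏ i ∈ σ, (MvPolynomial.X i : MvPolynomial (Fin n) K) ∈ Δ.stanleyReisnerIdeal K :=
    Ideal.subset_span ⟨σ, hσ, rfl⟩
  rw [prod_X_eq_monomial, ← hM.prop, MvPolynomial.mem_ideal_span_monomial_image] at hmem
  obtain ⟨a, haM, hle⟩ := hmem (∑ i ∈ σ, Finsupp.single i 1) (by simp)
  obtain ⟨τ, h1, h2, h3⟩ := Δ.exists_nonface_of_monomial_mem (K := K) (a := a)
    (hM.prop ▸ Ideal.subset_span ⟨a, haM, rfl⟩)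
  refine ⟨τ, fun j hj => ?_, h3.trans (hMs ⟨a, haM, rfl⟩), h1⟩
  have h4 := Finsupp.mem_support_iff.1 (h2 hj)
  have h5 := hle j
  rw [sum_single_apply] at h5
  by_contra h6
  rw [if_neg h6] at h5
  omega

lemma exists_nonface {K : Type*} [Field K] {s : ℕ}
    (hs : IsMaxGeneratorDegree (Δ.stanleyReisnerIdeal K) s) :
    ∃ σ, ¬ Δ.IsFace σ ∧ σ.card ≤ s := by
  obtain ⟨M, hM, ⟨a, haM, rfl⟩, -⟩ := hs
  obtain ⟨σ, h1, -, h3⟩ := Δ.exists_nonface_of_monomial_mem (K := K) (a := a)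
    (hM.prop ▸ Ideal.subset_span ⟨a, haM, rfl⟩)
  exact ⟨σ, h1, h3⟩

end PreAbstractSimplicialComplex

/-! ### Connectivity of the 1-skeleton. -/

open SimplicialChain in
theorem corollary4p1 {n : ℕ} (Δ : PreAbstractSimplicialComplex (Fin n)) (h : ℕ)
    (hΔ : PreAbstractSimplicialComplex.IsVertexMinimalCycle.{u} Δ (h : ℤ))
    (K : Type v) [Field K] (s : ℕ)
    (hs : IsMaxGeneratorDegree (Δ.stanleyReisnerIdeal K) s) :
    Δ.oneSkeleton.IsMConnected ⌈((s : ℚ) * (h : ℚ)) / ((s : ℚ) - 1)⌉₊ := by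
  obtain ⟨k, _, hk⟩ := hΔ
  have hF := Δ.isLowerSet_isFace
  have hex : ∀ T : Finset (Fin n),
      ExactAt k {σ | σ ∈ {σ | Δ.IsFace σ} ∧ σ ⊆ T} (h + 1) ↔ T ≠ univ := by
    intro T
    rw [← isFace_restrict, Ne, ← hk T, nontrivial_reducedHomology_iff, not_not]
  have huniv : ¬ ExactAt k {σ | Δ.IsFace σ} (h + 1) := by
    simpa using not_congr (hex univ)
  have hvert : ∀ v, {v} ∈ Δ.faces := by
    intro v
    -- If `{v}` were not a face, `Δ` would equal its restriction to the other vertices, which is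
    -- exact by minimality.
    by_contra hv
    refine huniv ?_
    have h1 := (hex (univ.erase v)).2 fun h' =>
      notMem_erase v univ (by rw [h']; exact mem_univ v)
    convert h1 using 1
    ext σ
    refine ⟨fun hσ => ⟨hσ, fun w hw => mem_erase.2 ⟨?_, mem_univ w⟩⟩, fun hσ => hσ.1⟩
    rintro rfl
    rcases hF (singleton_subset_iff.2 hw) hσ with h' | h'
    · exact singleton_ne_empty w h'
    · exact hv h'
  -- The empty set and all singletons are faces, so `s ≥ 2` and the denominator `s - 1 = r` is
  -- positive.
  obtain ⟨r, hr, rfl⟩ : ∃ r, 1 ≤ r ∧ s = r + 1 := by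
    obtain ⟨σ, hσ, hσs⟩ := Δ.exists_nonface hs
    have h0 : σ.card ≠ 0 := fun h => hσ (Or.inl (card_eq_zero.1 h))
    have h1 : σ.card ≠ 1 := by
      intro h
      obtain ⟨v, rfl⟩ := card_eq_one.1 h
      exact hσ (Or.inr (hvert v))
    exact ⟨s - 1, by omega, by omega⟩
  have hgen : ∀ T, NonfacesGeneratedBy {σ | σ ∈ {σ | Δ.IsFace σ} ∧ σ ⊆ T} T (r + 1) := by
    intro T σ hσT hσ
    refine ⟨?_, hσT⟩
    by_contra hσ'
    obtain ⟨τ, h1, h2, h3⟩ := Δ.exists_small_nonface hs hσ'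
    exact h3 (hσ τ h1 h2).1
  have hlow : ∀ T, IsLowerSet {σ | σ ∈ {σ | Δ.IsFace σ} ∧ σ ⊆ T} :=
    fun T σ τ hτσ hσ => ⟨hF hτσ hσ.1, hτσ.trans hσ.2⟩
  have hrQ : (0 : ℚ) < r := by exact_mod_cast hr
  obtain ⟨m, hm⟩ : ∃ m, m = ⌈(((r + 1 : ℕ) : ℚ) * (h : ℚ)) / (((r + 1 : ℕ) : ℚ) - 1)⌉₊ := ⟨_, rfl⟩
  have hmle : ∀ w : ℕ, m ≤ w ↔ (r + 1) * h ≤ w * r := by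
    intro w
    rw [hm, Nat.ceil_le, Nat.cast_add, Nat.cast_one, add_sub_cancel_right, div_le_iff₀ hrQ]
    exact_mod_cast Iff.rfl
  rw [← hm]
  have hn : m + 1 ≤ n := by
    -- The bound for `Δ` itself, in dimension `h`, reads `(r + 1) * (h + 1) ≤ n * r`; removing one
    -- vertex costs only `r`, so `m ≤ n - 1`.
    have h1 := card_bound (hlow univ) (fun σ _ => subset_univ σ) (hgen univ)
      (fun h' => (hex univ).1 h' rfl)
    rw [card_univ, Fintype.card_fin] at h1
    rcases n with _ | n
    · simp at h1
    · have := (hmle n).2 (by nlinarith)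
      omega
  refine ⟨?_, fun W hW => ?_⟩
  · rw [ENat.card_congr (Equiv.subtypeUnivEquiv hvert), ENat.card_eq_coe_fintype_card,
      Fintype.card_fin]
    exact_mod_cast hn
  · have hWim : (W.map (Function.Embedding.subtype _)).card = W.card := card_map _
    obtain ⟨W', hW'⟩ : ∃ W', W' = W.map (Function.Embedding.subtype _) := ⟨_, rfl⟩
    rw [← hW'] at hWim
    have hmemW : ∀ x : {v : Fin n // ({v} : Finset (Fin n)) ∈ Δ.faces}, x.1 ∈ W' ↔ x ∈ W := by
      intro x
      rw [hW']
      exact mem_map' (Function.Embedding.subtype _)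
    obtain ⟨G, hG⟩ : ∃ G, G = Δ.oneSkeleton.induce ((W : Set _)ᶜ) := ⟨_, rfl⟩
    rw [← hG]
    have hnon : Nonempty ((W : Set {v : Fin n // ({v} : Finset (Fin n)) ∈ Δ.faces})ᶜ : Set _) := by
      obtain ⟨x, hx⟩ : ∃ x, x ∉ W' := by
        by_contra! hall
        have : W' = univ := eq_univ_iff_forall.2 hall
        rw [this, card_univ, Fintype.card_fin] at hWim
        omega
      exact ⟨⟨⟨x, hvert x⟩, fun h' => hx ((hmemW ⟨x, hvert x⟩).2 h')⟩⟩
    refine ⟨fun a b => ?_⟩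
    by_contra hab
    classical
    -- `A` is the set of vertices in the component of `a` after `W` is deleted.
    have hreach : ∃ A : Finset (Fin n), ∀ x, x ∈ A ↔ ∃ hx : x ∉ W',
        G.Reachable a ⟨⟨x, hvert x⟩, fun h' => hx ((hmemW ⟨x, hvert x⟩).2 h')⟩ :=
      ⟨univ.filter fun x => ∃ hx : x ∉ W',
        G.Reachable a ⟨⟨x, hvert x⟩, fun h' => hx ((hmemW ⟨x, hvert x⟩).2 h')⟩, by simp⟩
    obtain ⟨A, hA⟩ := hreach
    have haA : a.1.1 ∈ A := (hA _).2 ⟨fun h' => a.2 ((hmemW a.1).1 h'), SimpleGraph.Reachable.refl _⟩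
    have hbA : b.1.1 ∉ A := fun h' => hab ((hA _).1 h').2
    have hbW : b.1.1 ∉ W' := fun h' => b.2 ((hmemW b.1).1 h')
    have hdisj : ∀ x ∈ W', x ∉ A := fun x hx h' => ((hA x).1 h').1 hx
    have hI : ¬ ExactAt k {σ | σ ∈ {σ | Δ.IsFace σ} ∧ σ ⊆ (A ∪ W') ∩ Aᶜ} h := by
      intro hI
      refine huniv (exactAt_of_cover hF ?_ ((hex (A ∪ W')).2 ?_) ((hex Aᶜ).2 ?_) hI)
      -- A face contained in neither part has a vertex in `A` and one outside `A ∪ W'`. These two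
      -- span an edge, which would put the second one in the component too.
      · intro σ hσ
        by_contra! hcon
        obtain ⟨⟨y, hyσ, hy⟩, x, hxσ, hx⟩ :=
          And.intro (not_subset.1 hcon.1) (not_subset.1 hcon.2)
        rw [mem_compl, not_not] at hx
        rw [mem_union, not_or] at hy
        obtain ⟨hxW, hxr⟩ := (hA x).1 hx
        refine hy.1 ((hA y).2 ⟨hy.2, hxr.trans (SimpleGraph.Adj.reachable ?_)⟩)
        have hxy : x ≠ y := fun h' => hy.1 (h' ▸ hx)
        rw [hG, SimpleGraph.comap_adj]
        refine ⟨fun h' => hxy (congrArg Subtype.val h'), ?_⟩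
        rcases hF (insert_subset hxσ (singleton_subset_iff.2 hyσ)) hσ with h' | h'
        · exact absurd h' (insert_ne_empty x {y})
        · exact h'
      · intro h'
        have := h' ▸ mem_univ b.1.1
        rcases mem_union.1 this with h1 | h1
        · exact hbA h1
        · exact hbW h1
      · intro h'
        exact mem_compl.1 (h' ▸ mem_univ a.1.1) haA
    have hWeq : (A ∪ W') ∩ Aᶜ = W' := by
      ext x
      simp only [mem_inter, mem_union, mem_compl]
      exact ⟨fun hx => hx.1.resolve_left hx.2, fun hx => ⟨Or.inr hx, hdisj x hx⟩⟩
    rw [hWeq] at hI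
    have h1 := (hmle _).2 (card_bound (hlow W') (fun σ hσ => hσ.2) (hgen W') hI)
    omega
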